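/- Let $L$ be a completely regular frame: a complete lattice in which $a\wedge\bigvee S=\bigvee\{a\wedge s\mid s\in S\}$ for all $a\in L$, $S\subseteq L$, and in which every $a\in L$ is the join of all $x\in L$ with $x\prec\!\prec a$. Here $a\prec b$ means that $a\wedge t=0$ and $t\vee b=1$ for some $t\in L$, and $a\prec\!\prec b$ means that there are elements $c_q\in L$ ($q\in\mathbb Q\cap[0,1]$) with $c_0=a$, $c_1=b$ and $c_r\prec c_s$ whenever $r<s$. Let $\mathcal L(\mathbb R)$ be the frame of reals, that is, the frame generated by the pairs $(p,q)$ of rationals subject to (R1) $(p,q)\wedge(r,s)=(p\vee r,q\wedge s)$; (R2) $(p,q)\vee(r,s)=(p,s)$ whenever $p\le r<q\le s$; (R3) $(p,q)=\bigvee\{(r,s)\mid p<r<s<q\}$; (R4) $1=\bigvee\{(p,q)\mid p,q\in\mathbb Q\}$. Let $\mathcal RL$ be the set of frame homomorphisms $\mathcal L(\mathbb R)\to L$. A cozero element of $L$ is an element of the form $\operatorname{coz}\varphi=\bigvee\{\varphi(p,0)\vee\varphi(0,q)\mid p,q\in\mathbb Q\}$ with $\varphi\in\mathcal RL$. The frame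 $L$ is pseudocompact if for every $\varphi\in\mathcal RL$ there are $p,q\in\mathbb Q$ with $\varphi(p,q)=1$; it is compact if its top element is compact, that is, every $S\subseteq L$ with $\bigvee S=1$ has a finite subset $F$ with $\bigvee F=1$. Call $L$ a $P_F$-frame if, whenever $a,b\in L$ are cozero elements with $a\wedge b=0$, at least one of $a$, $b$ is complemented in $L$. If $L$ is a compact $P_F$-frame, then $L$ is finite. More generally, if $L$ is a pseudocompact $P_F$-frame, then $L$ is finite. -/

import Mathlib

universe u

/-- The frame of reals `𝓛(ℝ)`: the frame presented by generators `(p, q)`, `p q : ℚ`, and relations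
* (R1) `(p, q) ∧ (r, s) = (p ∨ r, q ∧ s)`;
* (R2) `(p, q) ∨ (r, s) = (p, s)` whenever `p ≤ r < q ≤ s`;
* (R3) `(p, q) = ⋁ {(r, s) | p < r < s < q}`;
* (R4) `1 = ⋁ {(p, q) | p q : ℚ}`.

By (R1) the generators form a meet-semilattice, so the presented frame is realised by the sets of
generators that are downward closed and saturated for the covers (R2) and (R3), ordered by
inclusion; the universal property is `FrameOfReals.lift`, `FrameOfReals.lift_gen` and
`FrameOfReals.hom_ext` below. -/
@[ext]
structure FrameOfReals where
  carrier : Set (ℚ × ℚ)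
  lower : ∀ p q r s : ℚ, (p, q) ∈ carrier → p ≤ r → s ≤ q → (r, s) ∈ carrier
  glue : ∀ p q r s : ℚ, p ≤ r → r < q → q ≤ s →
    (p, q) ∈ carrier → (r, s) ∈ carrier → (p, s) ∈ carrier
  round : ∀ p q : ℚ, (∀ r s : ℚ, p < r → r < s → s < q → (r, s) ∈ carrier) → (p, q) ∈ carrier

namespace FrameOfReals

instance : PartialOrder FrameOfReals :=
  PartialOrder.lift carrier (fun _ _ h => FrameOfReals.ext h)

theorem le_def {I J : FrameOfReals} : I ≤ J ↔ I.carrier ⊆ J.carrier := Iff.rfl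

instance : InfSet FrameOfReals where
  sInf S :=
    { carrier := {x | ∀ I ∈ S, x ∈ I.carrier}
      lower := fun p q r s h h1 h2 I hI => I.lower p q r s (h I hI) h1 h2
      glue := fun p q r s h1 h2 h3 h4 h5 I hI => I.glue p q r s h1 h2 h3 (h4 I hI) (h5 I hI)
      round := fun p q h I hI => I.round p q (fun r s h1 h2 h3 => h r s h1 h2 h3 I hI) }

theorem mem_sInf {S : Set FrameOfReals} {x : ℚ × ℚ} :
    x ∈ (sInf S).carrier ↔ ∀ I ∈ S, x ∈ I.carrier := Iff.rfl

instance : CompleteLattice FrameOfReals :=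
  completeLatticeOfInf FrameOfReals (fun S =>
    ⟨fun I hI _ hx => hx I hI, fun _ hJ _ hx I hI => hJ hI hx⟩)

theorem mem_inf {I J : FrameOfReals} {x : ℚ × ℚ} :
    x ∈ (I ⊓ J).carrier ↔ x ∈ I.carrier ∧ x ∈ J.carrier := by
  constructor
  · intro h
    exact ⟨le_def.1 inf_le_left h, le_def.1 inf_le_right h⟩
  · rintro ⟨h1, h2⟩ K hK
    rcases hK with rfl | rfl
    exacts [h1, h2]

/-- The largest `K` with `I ⊓ K ≤ J`. -/
def residual (I J : FrameOfReals) : FrameOfReals where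
  carrier := {x | ∀ r s : ℚ, (r, s) ∈ I.carrier → (max x.1 r, min x.2 s) ∈ J.carrier}
  lower := fun p q r s h h1 h2 a b hab =>
    J.lower _ _ _ _ (h a b hab) (max_le_max h1 le_rfl) (min_le_min h2 le_rfl)
  glue := by
    intro p q r s h1 h2 h3 h4 h5 a b hab
    have h4' := h4 a b hab
    have h5' := h5 a b hab
    simp only at h4' h5' ⊢
    by_cases h : max r a < min q b
    · exact J.glue _ _ _ _ (max_le_max h1 le_rfl) h (min_le_min h3 le_rfl) h4' h5'
    · rw [not_lt, min_le_iff, le_max_iff, le_max_iff] at h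
      by_cases hqa : q ≤ a
      · refine J.lower _ _ _ _ h5' ?_ le_rfl
        exact max_le ((h2.le.trans hqa).trans (le_max_right _ _)) (le_max_right _ _)
      · by_cases hbr : b ≤ r
        · refine J.lower _ _ _ _ h4' le_rfl ?_
          exact le_min ((min_le_right _ _).trans (hbr.trans h2.le)) (min_le_right _ _)
        · have hba : b ≤ a := by
            rcases h with (h | h) | (h | h)
            · exact absurd h (not_le.2 h2)
            · exact absurd h hqa
            · exact absurd h hbr
            · exact h
          refine J.round _ _ (fun c d hc hcd hd => ?_)
          have h6 := (max_lt_iff.1 hc).2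
          have h7 := (lt_min_iff.1 hd).2
          linarith
  round := by
    intro p q h a b hab
    refine J.round _ _ (fun c d hc hcd hd => ?_)
    have hc' := max_lt_iff.1 hc
    have hd' := lt_min_iff.1 hd
    have := h c d hc'.1 hcd hd'.1 a b hab
    rwa [max_eq_left hc'.2.le, min_eq_left hd'.2.le] at this

theorem le_residual {I J K : FrameOfReals} : K ≤ residual I J ↔ I ⊓ K ≤ J := by
  constructor
  · rintro h ⟨p, q⟩ hx
    have hx' := mem_inf.1 hx
    have := h hx'.2 p q hx'.1
    simpa using this
  · rintro h ⟨p, q⟩ hx r s hrs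
    exact h (mem_inf.2 ⟨I.lower _ _ _ _ hrs (le_max_right _ _) (min_le_right _ _),
      K.lower _ _ _ _ hx (le_max_left _ _) (min_le_left _ _)⟩)

instance : Order.Frame FrameOfReals :=
  Order.Frame.ofMinimalAxioms
    { inf_sSup_le_iSup_inf := fun I S =>
        le_residual.1 (sSup_le fun K hK =>
          le_residual.2 (le_iSup₂ (f := fun K (_ : K ∈ S) => I ⊓ K) K hK)) }

/-- The generator `(p, q)` of `𝓛(ℝ)`. -/
def gen (p q : ℚ) : FrameOfReals := sInf {I | (p, q) ∈ I.carrier}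

theorem gen_le {p q : ℚ} {I : FrameOfReals} : gen p q ≤ I ↔ (p, q) ∈ I.carrier :=
  ⟨fun h => h (fun _ hJ => hJ), fun h => sInf_le h⟩

theorem eq_iSup_gen (I : FrameOfReals) : I = ⨆ x ∈ I.carrier, gen x.1 x.2 := by
  apply le_antisymm
  · intro x hx
    exact gen_le.1 (le_iSup₂ (f := fun (x : ℚ × ℚ) (_ : x ∈ I.carrier) => gen x.1 x.2) x hx)
  · exact iSup₂_le fun x hx => gen_le.2 hx

/-- The relations (R1)-(R4) for a family of elements of a frame indexed by pairs of rationals. -/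
structure Relations {L : Type u} [Order.Frame L] (f : ℚ → ℚ → L) : Prop where
  r1 : ∀ p q r s : ℚ, f p q ⊓ f r s = f (max p r) (min q s)
  r2 : ∀ p q r s : ℚ, p ≤ r → r < q → q ≤ s → f p q ⊔ f r s = f p s
  r3 : ∀ p q : ℚ, f p q = sSup {x | ∃ r s : ℚ, p < r ∧ r < s ∧ s < q ∧ x = f r s}
  r4 : sSup {x | ∃ p q : ℚ, x = f p q} = ⊤

theorem gen_mono {p q r s : ℚ} (h1 : p ≤ r) (h2 : s ≤ q) : gen r s ≤ gen p q :=
  gen_le.2 ((gen p q).lower _ _ _ _ (gen_le.1 le_rfl) h1 h2)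

/-- The generator `(p, q)`, computed. -/
def principal (p q : ℚ) : FrameOfReals where
  carrier := {x | x.2 ≤ x.1 ∨ (p ≤ x.1 ∧ x.2 ≤ q)}
  lower := by
    rintro a b c d (h | ⟨h1, h2⟩) h3 h4
    · exact Or.inl (h4.trans (le_trans h h3))
    · exact Or.inr ⟨le_trans h1 h3, h4.trans h2⟩
  glue := by
    rintro a b c d h1 h2 h3 (h4 | h4) (h5 | h5)
    · exact absurd h4 (not_le.2 (h1.trans_lt h2))
    · exact absurd h4 (not_le.2 (h1.trans_lt h2))
    · exact absurd h5 (not_le.2 (h2.trans_le h3))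
    · exact Or.inr ⟨h4.1, h5.2⟩
  round := by
    intro a b h
    rcases le_or_gt b a with hab | hab
    · exact Or.inl hab
    · refine Or.inr ⟨?_, ?_⟩
      · refine le_of_forall_gt_imp_ge_of_dense (fun c hc => ?_)
        by_contra hcp
        obtain ⟨e, he1, he2⟩ := exists_between (lt_min hc hab)
        obtain ⟨d, hd1, hd2⟩ := exists_between (lt_min_iff.1 he2).2
        rcases h e d he1 hd1 hd2 with h' | h'
        · exact absurd h' (not_le.2 hd1)
        · exact hcp (h'.1.trans (lt_min_iff.1 he2).1.le)
      · refine le_of_forall_lt_imp_le_of_dense (fun c hc => ?_)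
        by_contra hcp
        obtain ⟨e, he1, he2⟩ := exists_between (max_lt hc hab)
        obtain ⟨d, hd1, hd2⟩ := exists_between (max_lt_iff.1 he1).2
        rcases h d e hd1 hd2 he2 with h' | h'
        · exact absurd h' (not_le.2 hd2)
        · exact hcp ((max_lt_iff.1 he1).1.le.trans h'.2)

theorem relations_gen : Relations gen where
  r1 p q r s := by
    refine le_antisymm ?_ (le_inf (gen_mono (le_max_left _ _) (min_le_left _ _))
      (gen_mono (le_max_right _ _) (min_le_right _ _)))
    have h : gen r s ≤ residual (gen p q) (gen (max p r) (min q s)) := by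
      have h' : gen p q ≤ principal p q := gen_le.2 (Or.inr ⟨le_rfl, le_rfl⟩)
      rw [gen_le]
      intro a b hab
      rcases h' hab with h | ⟨h1, h2⟩
      · refine FrameOfReals.round _ _ _ (fun c d hc hcd hd => ?_)
        have h6 := (max_lt_iff.1 hc).2
        have h7 := (lt_min_iff.1 hd).2
        simp only at h
        linarith
      · refine gen_le.1 (gen_mono ?_ ?_)
        · rw [max_comm]
          exact max_le_max le_rfl h1
        · rw [min_comm q]
          exact min_le_min le_rfl h2
    exact le_residual.1 h
  r2 p q r s h1 h2 h3 := by
    apply le_antisymm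
    · exact sup_le (gen_mono le_rfl h3) (gen_mono h1 le_rfl)
    · rw [gen_le]
      exact (gen p q ⊔ gen r s).glue _ _ _ _ h1 h2 h3 (gen_le.1 le_sup_left)
        (gen_le.1 le_sup_right)
  r3 p q := by
    apply le_antisymm
    · rw [gen_le]
      refine FrameOfReals.round _ _ _ (fun r s h1 h2 h3 => gen_le.1 (le_sSup ⟨r, s, h1, h2, h3, rfl⟩))
    · apply sSup_le
      rintro x ⟨r, s, h1, h2, h3, rfl⟩
      exact gen_mono h1.le h3.le
  r4 := by
    refine eq_top_iff.2 (fun x _ => gen_le.1 (le_sSup ⟨x.1, x.2, rfl⟩))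

theorem Relations.mono {L : Type u} [Order.Frame L] {f : ℚ → ℚ → L} (hf : Relations f)
    {p q r s : ℚ} (h1 : p ≤ r) (h2 : s ≤ q) : f r s ≤ f p q := by
  have h := hf.r1 p q r s
  rw [max_eq_right h1, min_eq_right h2] at h
  exact inf_eq_right.1 h

/-- The universal property of `𝓛(ℝ)`, existence: a family in a frame `L` that satisfies (R1)-(R4)
extends to a frame homomorphism `𝓛(ℝ) → L`. -/
def lift {L : Type u} [Order.Frame L] (f : ℚ → ℚ → L) (hf : Relations f) :
    FrameHom FrameOfReals L where
  toFun I := ⨆ x ∈ I.carrier, f x.1 x.2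
  map_inf' I J := by
    apply le_antisymm
    · refine iSup₂_le (fun x hx => le_inf ?_ ?_)
      · exact le_iSup₂ (f := fun (x : ℚ × ℚ) (_ : x ∈ I.carrier) => f x.1 x.2) x (mem_inf.1 hx).1
      · exact le_iSup₂ (f := fun (x : ℚ × ℚ) (_ : x ∈ J.carrier) => f x.1 x.2) x (mem_inf.1 hx).2
    · rw [iSup₂_inf_eq]
      refine iSup₂_le (fun x hx => ?_)
      rw [inf_iSup₂_eq]
      refine iSup₂_le (fun y hy => ?_)
      rw [hf.r1]
      exact le_iSup₂ (f := fun (x : ℚ × ℚ) (_ : x ∈ (I ⊓ J).carrier) => f x.1 x.2)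
        (max x.1 y.1, min x.2 y.2)
        (mem_inf.2 ⟨I.lower _ _ _ _ hx (le_max_left _ _) (min_le_left _ _),
          J.lower _ _ _ _ hy (le_max_right _ _) (min_le_right _ _)⟩)
  map_top' := by
    refine eq_top_iff.2 (hf.r4.symm.le.trans (sSup_le ?_))
    rintro x ⟨p, q, rfl⟩
    exact le_iSup₂ (f := fun (x : ℚ × ℚ) (_ : x ∈ (⊤ : FrameOfReals).carrier) => f x.1 x.2)
      (p, q) (gen_le.1 le_top)
  map_sSup' S := by
    apply le_antisymm
    · let U : FrameOfReals :=
        { carrier := {x | f x.1 x.2 ≤ sSup ((fun I : FrameOfReals =>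
            ⨆ x ∈ I.carrier, f x.1 x.2) '' S)}
          lower := fun p q r s h h1 h2 => (hf.mono h1 h2).trans h
          glue := fun p q r s h1 h2 h3 h4 h5 => (hf.r2 p q r s h1 h2 h3).symm.le.trans
            (sup_le h4 h5)
          round := fun p q h => (hf.r3 p q).le.trans (sSup_le (by
            rintro x ⟨r, s, h1, h2, h3, rfl⟩
            exact h r s h1 h2 h3)) }
      have hU : sSup S ≤ U := sSup_le (fun I hI x hx =>
        (le_iSup₂ (f := fun (x : ℚ × ℚ) (_ : x ∈ I.carrier) => f x.1 x.2) x hx).trans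
          (le_sSup ⟨I, hI, rfl⟩))
      exact iSup₂_le (fun x hx => hU hx)
    · apply sSup_le
      rintro _ ⟨I, hI, rfl⟩
      exact iSup₂_le (fun x hx => le_iSup₂
        (f := fun (x : ℚ × ℚ) (_ : x ∈ (sSup S).carrier) => f x.1 x.2) x (le_sSup hI hx))

theorem lift_gen {L : Type u} [Order.Frame L] (f : ℚ → ℚ → L) (hf : Relations f) (p q : ℚ) :
    lift f hf (gen p q) = f p q := by
  apply le_antisymm
  · refine iSup₂_le (fun x hx => ?_)
    rcases (gen_le (I := principal p q)).2 (Or.inr ⟨le_rfl, le_rfl⟩) hx with h | h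
    · rw [hf.r3]
      refine sSup_le ?_
      rintro _ ⟨r, s, h1, h2, h3, -⟩
      exact absurd (h1.trans (h2.trans h3)) (not_lt.2 h)
    · exact hf.mono h.1 h.2
  · exact le_iSup₂ (f := fun (x : ℚ × ℚ) (_ : x ∈ (gen p q).carrier) => f x.1 x.2) (p, q)
      (gen_le.1 le_rfl)

/-- The universal property of `𝓛(ℝ)`, uniqueness. -/
theorem hom_ext {L : Type u} [Order.Frame L] {φ ψ : FrameHom FrameOfReals L}
    (h : ∀ p q : ℚ, φ (gen p q) = ψ (gen p q)) : φ = ψ := by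
  refine FrameHom.ext (fun I => ?_)
  rw [eq_iSup_gen I]
  simp only [map_iSup, h]

end FrameOfReals

namespace PointFree

variable {L : Type u} [Order.Frame L]

/-- `a ≺ b`: `a` is rather below `b`. -/
def RatherBelow (a b : L) : Prop := ∃ t : L, a ⊓ t = ⊥ ∧ t ⊔ b = ⊤

/-- `a ≺≺ b`: `a` is completely below `b`. Only the values of `c` on `ℚ ∩ [0, 1]` matter. -/
def CompletelyBelow (a b : L) : Prop :=
  ∃ c : ℚ → L, c 0 = a ∧ c 1 = b ∧ ∀ r s : ℚ, 0 ≤ r → r < s → s ≤ 1 → RatherBelow (c r) (c s)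

variable (L) in
/-- `L` is a completely regular frame. -/
def IsCompletelyRegular : Prop := ∀ a : L, a = sSup {x : L | CompletelyBelow x a}

variable (L) in
/-- (The underlying set of) the ring `𝓡L` of real-valued continuous functions on `L`: the frame
homomorphisms `𝓛(ℝ) → L`. -/
abbrev ContinuousReal : Type u := FrameHom FrameOfReals L

/-- The cozero element of `φ ∈ 𝓡L`: the join of all `φ(p, 0) ∨ φ(0, q)`. -/
def coz (φ : ContinuousReal L) : L :=
  ⨆ (p : ℚ) (q : ℚ), φ (FrameOfReals.gen p 0) ⊔ φ (FrameOfReals.gen 0 q)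

variable (L) in
/-- `Coz L`, the set of cozero elements of `L`. -/
def Coz : Set L := Set.range (coz : ContinuousReal L → L)

/-- `φ ∈ 𝓡L` is bounded. -/
def IsBounded (φ : ContinuousReal L) : Prop := ∃ p q : ℚ, φ (FrameOfReals.gen p q) = ⊤

variable (L) in
/-- `L` is pseudocompact: every element of `𝓡L` is bounded. -/
def IsPseudocompact : Prop := ∀ φ : ContinuousReal L, IsBounded φ

variable (L) in
/-- `L` is compact: its top element is a compact element. -/
def IsCompactFrame : Prop := IsCompactElement (⊤ : L)

variable (L) in
/-- `L` is a `P_F`-frame: of any two disjoint cozero elements at least one is complemented. -/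
def IsPFFrame : Prop :=
  ∀ a ∈ Coz L, ∀ b ∈ Coz L, a ⊓ b = ⊥ → IsComplemented a ∨ IsComplemented b

end PointFree

/-! An infinite completely regular frame has infinitely many regular elements, because every element
is a join of regular ones (`finite_of_finite_regular`). An infinite Boolean algebra contains
infinitely many nonzero, pairwise disjoint elements. Complete regularity shrinks these to nonzero `b
n` all of whose subsequences have cozero joins (`exists_disjoint_cozero_sequence`).

The joins over even and over odd indices are then disjoint cozero elements, so the `P_F` property
complements one of them. On a complemented join of disjoint nonzero pieces, the step function with
value `n` on the `n`-th piece, extended by `0` on the complement, is continuous and unbounded, which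
contradicts pseudocompactness. Compactness implies pseudocompactness. -/

namespace PointFree

open FrameOfReals

/-! ### Real-valued functions from scales, and cozero elements -/

section Scale

variable {L : Type u} [Order.Frame L]

/-- The pseudocomplement is the largest element disjoint from `a`, hence the best possible witness.
-/
theorem ratherBelow_iff {a b : L} : RatherBelow a b ↔ aᶜ ⊔ b = ⊤ := by
  constructor
  · rintro ⟨t, h1, h2⟩
    have : t ≤ aᶜ := le_compl_iff_disjoint_left.2 (disjoint_iff.2 h1)
    exact eq_top_iff.2 (h2.symm.le.trans (sup_le_sup_right this b))
  · exact fun h => ⟨aᶜ, inf_compl_self a, h⟩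

theorem RatherBelow.le {a b : L} (h : RatherBelow a b) : a ≤ b := by
  obtain ⟨t, h1, h2⟩ := h
  calc a = a ⊓ (t ⊔ b) := by rw [h2, inf_top_eq]
    _ = a ⊓ b := by rw [inf_sup_left, h1, bot_sup_eq]
    _ ≤ b := inf_le_right

theorem RatherBelow.mono {a a' b b' : L} (h : RatherBelow a b) (ha : a' ≤ a) (hb : b ≤ b') :
    RatherBelow a' b' := by
  rw [ratherBelow_iff] at h ⊢
  exact eq_top_iff.2 (h.symm.le.trans (sup_le_sup (compl_le_compl ha) hb))

theorem ratherBelow_bot (b : L) : RatherBelow ⊥ b := ⟨⊤, by simp, by simp⟩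

theorem ratherBelow_top (a : L) : RatherBelow a ⊤ := ⟨⊥, by simp, by simp⟩

theorem RatherBelow.sup {a b c d : L} (h : RatherBelow a b) (h' : RatherBelow c d) :
    RatherBelow (a ⊔ c) (b ⊔ d) := by
  rw [ratherBelow_iff] at h h' ⊢
  rw [compl_sup, sup_inf_right, ← sup_assoc, h, top_sup_eq, sup_left_comm, h', sup_top_eq,
    inf_top_eq]

theorem RatherBelow.finset_sup {ι : Type*} (F : Finset ι) {x y : ι → L}
    (h : ∀ i ∈ F, RatherBelow (x i) (y i)) : RatherBelow (F.sup x) (F.sup y) := by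
  classical
  induction F using Finset.induction_on with
  | empty => exact ratherBelow_bot _
  | insert i F hi ih =>
    rw [Finset.sup_insert, Finset.sup_insert]
    exact (h i (Finset.mem_insert_self i F)).sup
      (ih fun j hj => h j (Finset.mem_insert_of_mem hj))

theorem RatherBelow.compl_compl_le {a b : L} (h : RatherBelow a b) : aᶜᶜ ≤ b := by
  refine RatherBelow.le (ratherBelow_iff.2 ?_)
  rw [compl_compl_compl]
  exact ratherBelow_iff.1 h

theorem CompletelyBelow.ratherBelow {a b : L} (h : CompletelyBelow a b) : RatherBelow a b := by
  obtain ⟨c, rfl, rfl, h⟩ := h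
  exact h 0 1 le_rfl one_pos le_rfl

/-- A scale in `L`: an increasing family for `≺` that is the family of sublevels of a real-valued
continuous function, up to the choice between `<` and `≤`. -/
structure IsScale (s : ℚ → L) : Prop where
  ratherBelow : ∀ p q : ℚ, p < q → RatherBelow (s p) (s q)
  iSup_eq_top : ⨆ r, s r = ⊤
  iSup_compl_eq_top : ⨆ r, (s r)ᶜ = ⊤

/-- The open sublevel of a scale. -/
def sublevel (s : ℚ → L) (q : ℚ) : L := ⨆ r, ⨆ (_ : r < q), s r

/-- The open superlevel of a scale. -/
def superlevel (s : ℚ → L) (p : ℚ) : L := ⨆ r, ⨆ (_ : p < r), (s r)ᶜ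

theorem le_sublevel (s : ℚ → L) {r q : ℚ} (h : r < q) : s r ≤ sublevel s q :=
  le_iSup₂ (f := fun r (_ : r < q) => s r) r h

theorem compl_le_superlevel (s : ℚ → L) {p r : ℚ} (h : p < r) : (s r)ᶜ ≤ superlevel s p :=
  le_iSup₂ (f := fun r (_ : p < r) => (s r)ᶜ) r h

theorem sublevel_mono (s : ℚ → L) : Monotone (sublevel s) := fun _ _ h =>
  iSup₂_le fun _ hr => le_sublevel s (lt_of_lt_of_le hr h)

theorem superlevel_anti (s : ℚ → L) : Antitone (superlevel s) := fun _ _ h =>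
  iSup₂_le fun _ hr => compl_le_superlevel s (lt_of_le_of_lt h hr)

theorem sublevel_eq_iSup (s : ℚ → L) (q : ℚ) :
    sublevel s q = ⨆ r, ⨆ (_ : r < q), sublevel s r := by
  refine le_antisymm (iSup₂_le fun r hr => ?_) (iSup₂_le fun r hr => sublevel_mono s hr.le)
  obtain ⟨t, h1, h2⟩ := exists_between hr
  exact (le_sublevel s h1).trans (le_iSup₂ (f := fun r (_ : r < q) => sublevel s r) t h2)

theorem superlevel_eq_iSup (s : ℚ → L) (p : ℚ) :
    superlevel s p = ⨆ r, ⨆ (_ : p < r), superlevel s r := by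
  refine le_antisymm (iSup₂_le fun r hr => ?_) (iSup₂_le fun r hr => superlevel_anti s hr.le)
  obtain ⟨t, h1, h2⟩ := exists_between hr
  exact (compl_le_superlevel s h2).trans
    (le_iSup₂ (f := fun r (_ : p < r) => superlevel s r) t h1)

namespace IsScale

variable {s : ℚ → L}

theorem monotone (hs : IsScale s) : Monotone s := fun p q h => by
  rcases h.eq_or_lt with rfl | h
  exacts [le_rfl, (hs.ratherBelow p q h).le]

theorem superlevel_inf_sublevel (hs : IsScale s) {p q : ℚ} (h : q ≤ p) :
    superlevel s p ⊓ sublevel s q = ⊥ := by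
  rw [eq_bot_iff, superlevel, iSup₂_inf_eq]
  refine iSup₂_le fun r hr => ?_
  rw [sublevel, inf_iSup₂_eq]
  refine iSup₂_le fun t ht => ?_
  rw [← compl_inf_self (s r)]
  exact inf_le_inf_left _ (hs.monotone ((ht.le.trans h).trans hr.le))

theorem superlevel_sup_sublevel (hs : IsScale s) {p q : ℚ} (h : p < q) :
    superlevel s p ⊔ sublevel s q = ⊤ := by
  obtain ⟨r, h1, h2⟩ := exists_between h
  obtain ⟨t, h3, h4⟩ := exists_between h2
  exact eq_top_iff.2 ((ratherBelow_iff.1 (hs.ratherBelow r t h3)).symm.le.trans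
    (sup_le_sup (compl_le_superlevel s h1) (le_sublevel s h4)))

theorem iSup_sublevel (hs : IsScale s) : ⨆ q, sublevel s q = ⊤ :=
  eq_top_iff.2 (hs.iSup_eq_top.symm.le.trans (iSup_le fun r =>
    (le_sublevel s (lt_add_one r)).trans (le_iSup (sublevel s) _)))

theorem iSup_superlevel (hs : IsScale s) : ⨆ p, superlevel s p = ⊤ :=
  eq_top_iff.2 (hs.iSup_compl_eq_top.symm.le.trans (iSup_le fun r =>
    (compl_le_superlevel s (sub_one_lt r)).trans (le_iSup (superlevel s) _)))

/-- (R2) reduces by distributivity to superlevels and sublevels covering when they overlap; (R3)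
follows from their being joins of strictly smaller ones. -/
theorem relations (hs : IsScale s) :
    Relations fun p q => superlevel s p ⊓ sublevel s q where
  r1 p q r t := by
    have h1 : superlevel s (max p r) = superlevel s p ⊓ superlevel s r := by
      rcases le_total p r with h | h
      · rw [max_eq_right h, inf_eq_right.2 (superlevel_anti s h)]
      · rw [max_eq_left h, inf_eq_left.2 (superlevel_anti s h)]
    have h2 : sublevel s (min q t) = sublevel s q ⊓ sublevel s t := by
      rcases le_total q t with h | h
      · rw [min_eq_left h, inf_eq_left.2 (sublevel_mono s h)]
      · rw [min_eq_right h, inf_eq_right.2 (sublevel_mono s h)]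
    rw [h1, h2, inf_inf_inf_comm]
  r2 p q r t h1 h2 h3 := by
    rw [sup_inf_left, sup_inf_right, sup_inf_right, sup_eq_left.2 (superlevel_anti s h1),
      sup_comm (sublevel s q), hs.superlevel_sup_sublevel h2,
      hs.superlevel_sup_sublevel (h1.trans_lt (h2.trans_le h3)),
      sup_eq_right.2 (sublevel_mono s h3), inf_top_eq, top_inf_eq]
  r3 p q := by
    refine le_antisymm ?_ (sSup_le ?_)
    · rw [superlevel_eq_iSup s p, sublevel_eq_iSup s q, iSup₂_inf_eq]
      refine iSup₂_le fun r hr => ?_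
      rw [inf_iSup₂_eq]
      refine iSup₂_le fun t ht => ?_
      -- Pairs with `t ≤ r` do not occur in (R3), but they contribute only `⊥`.
      rcases lt_or_ge r t with h | h
      · exact le_sSup ⟨r, t, hr, h, ht, rfl⟩
      · rw [hs.superlevel_inf_sublevel h]
        exact bot_le
    · rintro _ ⟨r, t, h1, -, h3, rfl⟩
      exact inf_le_inf (superlevel_anti s h1.le) (sublevel_mono s h3.le)
  r4 := by
    refine eq_top_iff.2 ?_
    rw [← inf_top_eq (⊤ : L)]
    nth_rewrite 1 [← hs.iSup_superlevel]
    rw [← hs.iSup_sublevel, iSup_inf_eq]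
    refine iSup_le fun p => ?_
    rw [inf_iSup_eq]
    exact iSup_le fun q => le_sSup ⟨p, q, rfl⟩

/-- The real-valued continuous function determined by a scale. -/
noncomputable def toReal (hs : IsScale s) : ContinuousReal L := FrameOfReals.lift _ hs.relations

theorem toReal_gen (hs : IsScale s) (p q : ℚ) :
    hs.toReal (gen p q) = superlevel s p ⊓ sublevel s q := lift_gen _ hs.relations p q

theorem coz_toReal (hs : IsScale s) : coz hs.toReal = sublevel s 0 ⊔ superlevel s 0 := by
  simp only [coz, toReal_gen]
  refine le_antisymm (iSup₂_le fun p q => sup_le_sup inf_le_right inf_le_left) (sup_le ?_ ?_)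
  · conv_lhs => rw [← top_inf_eq (sublevel s 0), ← hs.iSup_superlevel, iSup_inf_eq]
    exact iSup_le fun p => le_iSup₂_of_le p 0 le_sup_left
  · conv_lhs => rw [← inf_top_eq (superlevel s 0), ← hs.iSup_sublevel, inf_iSup_eq]
    exact iSup_le fun q => le_iSup₂_of_le 0 q le_sup_right

end IsScale

/-- The cozero elements include the countable joins of upper ends of interpolating families. -/
theorem iSup_mem_Coz {c : ℕ → ℚ → L}
    (hc : ∀ n, ∀ r s : ℚ, 0 ≤ r → r < s → s ≤ 1 → RatherBelow (c n r) (c n s)) :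
    (⨆ n, ⨆ q, ⨆ (_ : 0 ≤ q ∧ q < 1), c n q) ∈ Coz L := by
  -- The `n`-th family is rescaled to the interval `[-1/(n+1), 0)`. The shrinking intervals leave
  -- only finitely many nonzero terms at each `r < 0`, as needed because `≺` is preserved by finite
  -- joins only.
  let x : ℚ → ℕ → L := fun r n => ⨆ (_ : 0 ≤ 1 + r * (n + 1)), c n (1 + r * (n + 1))
  let D : ℚ → L := fun r => if r < 0 then ⨆ n, x r n else ⊤
  have hx : ∀ r t : ℚ, r < t → t < 0 → ∀ n, RatherBelow (x r n) (x t n) := by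
    intro r t hrt ht n
    have hn : (0 : ℚ) < n + 1 := by positivity
    by_cases h : 0 ≤ 1 + r * (n + 1)
    · have h' : 1 + r * (n + 1) < 1 + t * (n + 1) := by
        have := mul_lt_mul_of_pos_right hrt hn
        linarith
      have h1 : 1 + t * (n + 1) ≤ 1 := by
        have := mul_neg_of_neg_of_pos ht hn
        linarith
      simp only [x, h, h.trans h'.le, iSup_true]
      exact hc n _ _ h h' h1
    · simp only [x, h, iSup_false]
      exact ratherBelow_bot _
  have hD : IsScale D :=
    { ratherBelow := by
        intro r t hrt
        by_cases ht : t < 0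
        · have hr := hrt.trans ht
          -- For `n ≥ N` one has `r * (n + 1) < -1`, so the `n`-th term vanishes.
          obtain ⟨N, hN⟩ := exists_nat_gt (-r)⁻¹
          have hle : ⨆ n, x r n ≤ (Finset.range N).sup (x r) := by
            refine iSup_le fun n => ?_
            by_cases hn : n < N
            · exact Finset.le_sup (f := x r) (Finset.mem_range.2 hn)
            · have h : ¬ 0 ≤ 1 + r * (n + 1) := by
                have h1 : (N : ℚ) ≤ n := by exact_mod_cast not_lt.1 hn
                have h2 : (-r)⁻¹ < n + 1 := by linarith
                have h3 := mul_lt_mul_of_pos_left h2 (neg_pos.2 hr)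
                rw [mul_inv_cancel₀ (neg_pos.2 hr).ne'] at h3
                intro h
                linarith
              simp only [x, h, iSup_false, bot_le]
          simp only [D, hr, ht, if_true]
          exact (RatherBelow.finset_sup _ fun n _ => hx r t hrt ht n).mono hle
            (Finset.sup_le fun n _ => le_iSup (x t) n)
        · simp only [D, ht, if_false]
          exact ratherBelow_top _
      iSup_eq_top := by
        refine eq_top_iff.2 (le_trans ?_ (le_iSup D 0))
        simp [D]
      iSup_compl_eq_top := by
        -- Any index below `-1` would do: it lies to the left of all the intervals, so `D` is `⊥`
        -- there.
        refine eq_top_iff.2 (le_trans ?_ (le_iSup (fun r => (D r)ᶜ) (-2)))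
        have h : ∀ n : ℕ, ¬ (0 : ℚ) ≤ 1 + -2 * (n + 1) := by
          intro n
          have : (0 : ℚ) ≤ n := by positivity
          linarith
        have h2 : (-2 : ℚ) < 0 := by norm_num
        simp only [D, x, h, h2, if_true, iSup_false, iSup_bot, compl_bot, le_rfl] }
  refine ⟨hD.toReal, ?_⟩
  have hsup : superlevel D 0 = ⊥ := by
    refine eq_bot_iff.2 (iSup₂_le fun r hr => ?_)
    simp [D, hr.le.not_gt]
  rw [hD.coz_toReal, hsup, sup_bot_eq]
  apply le_antisymm
  · refine iSup₂_le fun r hr => ?_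
    simp only [D, hr, if_true]
    refine iSup_mono fun n => iSup_le fun h => ?_
    have hn : (0 : ℚ) < n + 1 := by positivity
    have := mul_neg_of_neg_of_pos hr hn
    exact le_iSup₂_of_le (1 + r * (n + 1)) ⟨h, by linarith⟩ le_rfl
  · refine iSup_le fun n => iSup₂_le fun q hq => ?_
    have hn : (0 : ℚ) < n + 1 := by positivity
    have hr : (q - 1) / (n + 1) < 0 := div_neg_of_neg_of_pos (by linarith [hq.2]) hn
    have he : 1 + (q - 1) / (n + 1) * (n + 1) = q := by
      rw [div_mul_cancel₀ _ hn.ne']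
      ring
    refine le_trans ?_ (le_sublevel D hr)
    simp only [D, hr, if_true]
    refine le_iSup_of_le n ?_
    simp only [x, he, hq.1, iSup_true, le_rfl]

end Scale

/-! ### Disjoint sequences in infinite Boolean algebras -/

section Disjoint

/-- Each `z ≤ a` is the join of `z \ y` and `z ⊓ y`, so for a proper nonzero `y ≤ a` one of `a \ y`
and `y` has infinitely many elements below it; the other is cut off. -/
theorem exists_infinite_Iic_sdiff {B : Type*} [BooleanAlgebra B] {a : B}
    (ha : (Set.Iic a).Infinite) : ∃ x ≤ a, x ≠ ⊥ ∧ (Set.Iic (a \ x)).Infinite := by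
  obtain ⟨y, hy, hy'⟩ := ha.exists_notMem_finite (Set.toFinite {⊥, a})
  simp only [Set.mem_insert_iff, Set.mem_singleton_iff, not_or] at hy'
  by_cases h : (Set.Iic (a \ y)).Infinite
  · exact ⟨y, hy, hy'.1, h⟩
  · refine ⟨a \ y, sdiff_le, fun h0 => hy'.2 (le_antisymm hy (sdiff_eq_bot_iff.1 h0)), ?_⟩
    rw [sdiff_sdiff_right_self, inf_eq_right.2 hy]
    intro h'
    refine ha (((Set.not_infinite.1 h).image2 (· ⊔ ·) h').subset fun z hz => ?_)
    refine ⟨z \ y, sdiff_le_sdiff_right hz, z ⊓ y, inf_le_right, ?_⟩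
    exact (sup_comm _ _).trans (sup_inf_sdiff z y)

theorem exists_pairwise_disjoint_of_infinite (B : Type*) [BooleanAlgebra B] [Infinite B] :
    ∃ x : ℕ → B, (∀ n, x n ≠ ⊥) ∧ Pairwise fun m n => Disjoint (x m) (x n) := by
  have htop : (Set.Iic (⊤ : B)).Infinite := by
    rw [Set.Iic_top]
    exact Set.infinite_univ
  choose f hf hf0 hfi using fun a : {a : B // (Set.Iic a).Infinite} =>
    exists_infinite_Iic_sdiff a.2
  -- `g n` is what remains after `n` cuts; each new piece lies in the current remainder, disjoint
  -- from all earlier pieces.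
  let g : ℕ → {a : B // (Set.Iic a).Infinite} :=
    fun n => Nat.rec ⟨⊤, htop⟩ (fun _ a => ⟨a.1 \ f a, hfi a⟩) n
  have hg : ∀ n, (g (n + 1)).1 = (g n).1 \ f (g n) := fun _ => rfl
  have hanti : Antitone fun n => (g n).1 := antitone_nat_of_succ_le fun n => by
    rw [hg]
    exact sdiff_le
  refine ⟨fun n => f (g n), fun n => hf0 _, (pairwise_disjoint_on _).2 fun m n hmn => ?_⟩
  have h : f (g n) ≤ (g m).1 \ f (g m) := (hf (g n)).trans (hanti (Nat.succ_le_of_lt hmn))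
  exact disjoint_sdiff_self_right.mono_right h

end Disjoint

/-! ### Cozero sequences, unbounded functions and finiteness -/

section Finiteness

variable {L : Type u} [Order.Frame L]

/-- If `x ≺≺ a` then `x ≤ xᶜᶜ ≤ a`, so `a` is the join of the regular elements below it and is
determined by a set of regular elements. -/
theorem IsCompletelyRegular.finite_of_finite_regular (hreg : IsCompletelyRegular L)
    [Finite (Heyting.Regular L)] : Finite L := by
  refine Finite.of_surjective (fun S : Set (Heyting.Regular L) => sSup ((↑) '' S : Set L))
    fun a => ⟨{r | (r : L) ≤ a}, le_antisymm (sSup_le ?_) ?_⟩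
  · rintro _ ⟨r, hr, rfl⟩
    exact hr
  · conv_lhs => rw [hreg a]
    refine sSup_le fun x hx => le_trans le_compl_compl (le_sSup ?_)
    exact ⟨⟨xᶜᶜ, Heyting.isRegular_compl _⟩, hx.ratherBelow.compl_compl_le, rfl⟩

theorem IsCompletelyRegular.exists_disjoint_sequence (hreg : IsCompletelyRegular L)
    (hinf : ¬ Finite L) :
    ∃ x : ℕ → L, (∀ n, x n ≠ ⊥) ∧ ∀ m n, m ≠ n → x m ⊓ x n = ⊥ := by
  have : Infinite (Heyting.Regular L) := not_finite_iff_infinite.1 fun h =>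
    hinf hreg.finite_of_finite_regular
  obtain ⟨x, hx, hd⟩ := exists_pairwise_disjoint_of_infinite (Heyting.Regular L)
  exact ⟨fun n => x n, fun n h => hx n (Heyting.Regular.coe_injective h),
    fun m n h => congrArg (fun r : Heyting.Regular L => (r : L)) (disjoint_iff.1 (hd h))⟩

/-- An infinite completely regular frame has an infinite sequence of nonzero pairwise disjoint
elements, all of whose partial joins are cozero elements. -/
theorem IsCompletelyRegular.exists_disjoint_cozero_sequence (hreg : IsCompletelyRegular L)
    (hinf : ¬ Finite L) :
    ∃ b : ℕ → L, (∀ n, b n ≠ ⊥) ∧ (∀ m n, m ≠ n → b m ⊓ b n = ⊥) ∧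
      ∀ k : ℕ → ℕ, ⨆ n, b (k n) ∈ Coz L := by
  obtain ⟨x, hx, hd⟩ := hreg.exists_disjoint_sequence hinf
  have hy : ∀ n, ∃ y, CompletelyBelow y (x n) ∧ y ≠ ⊥ := by
    intro n
    by_contra! h
    refine hx n ?_
    rw [hreg (x n), eq_bot_iff]
    exact sSup_le fun y hy => (h y hy).le
  choose y hy hy0 using hy
  choose c hc0 hc1 hc using hy
  -- Stopping short of `q = 1` gives a cozero element between `y n` and `x n`.
  let b : ℕ → L := fun n => ⨆ q, ⨆ (_ : 0 ≤ q ∧ q < 1), c n q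
  have hle : ∀ n, b n ≤ x n := fun n => iSup₂_le fun q hq => by
    rw [← hc1 n]
    exact (hc n q 1 hq.1 hq.2 le_rfl).le
  have hge : ∀ n, y n ≤ b n := fun n => by
    rw [← hc0 n]
    exact le_iSup₂ (f := fun q (_ : 0 ≤ q ∧ q < 1) => c n q) 0 ⟨le_rfl, one_pos⟩
  refine ⟨b, fun n h => hy0 n ?_, fun m n h => ?_, fun k => iSup_mem_Coz fun n => hc (k n)⟩
  · rw [eq_bot_iff, ← h]
    exact hge n
  · rw [eq_bot_iff, ← hd m n h]
    exact inf_le_inf (hle m) (hle n)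

/-- The step function taking the value `n` on `b n` is unbounded. -/
theorem not_isPseudocompact_of_isComplemented_iSup {b : ℕ → L} (hb : ∀ n, b n ≠ ⊥)
    (hd : ∀ m n, m ≠ n → b m ⊓ b n = ⊥) (hc : IsComplemented (⨆ n, b n)) :
    ¬ IsPseudocompact L := by
  obtain ⟨w, hw⟩ := hc
  have hw0 : ∀ n, b n ⊓ w = ⊥ := fun n => by
    rw [eq_bot_iff, ← hw.inf_eq_bot]
    exact inf_le_inf_right _ (le_iSup b n)
  -- This is the open sublevel at `r` of the function with value `n` on `b n` and `0` on `w`.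
  let s : ℚ → L := fun r => if r ≤ 0 then ⊥ else w ⊔ ⨆ n : ℕ, ⨆ (_ : (n : ℚ) < r), b n
  have hbs : ∀ (n : ℕ) (r : ℚ), r ≤ n → b n ⊓ s r = ⊥ := by
    intro n r hr
    by_cases h : r ≤ 0
    · simp [s, h]
    · simp only [s, h, if_false]
      rw [inf_sup_left, hw0, bot_sup_eq, eq_bot_iff, inf_iSup₂_eq]
      refine iSup₂_le fun m hm => (hd n m ?_).le
      rintro rfl
      exact hr.not_gt hm
  have hs : IsScale s :=
    { ratherBelow := by
        intro p q hpq
        by_cases hp : p ≤ 0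
        · simp only [s, hp, if_true]
          exact ratherBelow_bot _
        · have hq : ¬ q ≤ 0 := fun h => hp (hpq.le.trans h)
          -- For `p > 0` this is the complement of `s p`; it covers together with `s q` because `w`
          -- and the `b n` join to `⊤`.
          refine ⟨⨆ n : ℕ, ⨆ (_ : p ≤ n), b n, ?_, ?_⟩
          · rw [eq_bot_iff, inf_comm, iSup₂_inf_eq]
            exact iSup₂_le fun n hn => (hbs n p hn).le
          · rw [eq_top_iff, ← hw.sup_eq_top]
            simp only [s, hq, if_false]
            refine sup_le (iSup_le fun n => ?_) (le_sup_of_le_right le_sup_left)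
            rcases le_or_gt p n with h | h
            · exact le_sup_of_le_left (le_iSup₂ (f := fun (n : ℕ) (_ : p ≤ n) => b n) n h)
            · exact le_sup_of_le_right (le_sup_of_le_right
                (le_iSup₂ (f := fun (n : ℕ) (_ : (n : ℚ) < q) => b n) n (h.trans hpq)))
      iSup_eq_top := by
        rw [eq_top_iff, ← hw.sup_eq_top]
        refine sup_le (iSup_le fun n => ?_) ?_
        · refine le_iSup_of_le ((n : ℚ) + 1) ?_
          have h : ¬ (n : ℚ) + 1 ≤ 0 := not_le.2 (by positivity)
          simp only [s, h, if_false]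
          exact le_sup_of_le_right
            (le_iSup₂ (f := fun (m : ℕ) (_ : (m : ℚ) < n + 1) => b m) n (lt_add_one _))
        · refine le_iSup_of_le 1 ?_
          have h : ¬ (1 : ℚ) ≤ 0 := by norm_num
          simp only [s, h, if_false]
          exact le_sup_left
      iSup_compl_eq_top := by
        refine eq_top_iff.2 (le_trans ?_ (le_iSup (fun r => (s r)ᶜ) 0))
        simp [s] }
  intro hps
  obtain ⟨p, q, h⟩ := hps hs.toReal
  rw [hs.toReal_gen] at h
  obtain ⟨n, hn⟩ := exists_nat_gt q
  refine hb n ?_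
  -- Boundedness makes the sublevel at `q` equal to `⊤`, yet `b n` with `n > q` is disjoint from it.
  rw [← inf_top_eq (b n), ← (inf_eq_top_iff.1 h).2, sublevel, inf_iSup₂_eq, eq_bot_iff]
  exact iSup₂_le fun r hr => (hbs n r (hr.trans hn).le).le

/-- The images of the intervals `(-n, n)` form a chain with join `⊤`, so by compactness one of them
is already `⊤`. -/
theorem IsCompactFrame.isPseudocompact (h : IsCompactFrame L) : IsPseudocompact L := by
  intro φ
  let I : ℕ → FrameOfReals := fun n => gen (-n) n
  have hI : Monotone I := fun m n hmn => by
    have : (m : ℚ) ≤ n := by exact_mod_cast hmn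
    exact gen_mono (neg_le_neg this) this
  have htop : ⨆ n, I n = ⊤ := by
    rw [eq_top_iff, ← relations_gen.r4]
    refine sSup_le ?_
    rintro _ ⟨p, q, rfl⟩
    obtain ⟨n, hn⟩ := exists_nat_gt (max (-p) q)
    rw [max_lt_iff] at hn
    exact le_iSup_of_le n (gen_mono (by linarith [hn.1]) hn.2.le)
  have hφ : ⨆ n, φ (I n) = ⊤ := by rw [← map_iSup, htop, map_top]
  obtain ⟨_, ⟨n, rfl⟩, hn⟩ := h (Set.range fun n => φ (I n)) ⊤ (Set.range_nonempty _)
    ((OrderHomClass.mono φ).comp hI).directed_le.directedOn_range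
    (hφ ▸ isLUB_iSup) le_rfl
  exact ⟨-n, n, top_le_iff.1 hn⟩

theorem IsPFFrame.finite (hreg : IsCompletelyRegular L) (hPF : IsPFFrame L)
    (hps : IsPseudocompact L) : Finite L := by
  by_contra hinf
  obtain ⟨b, hb, hd, hcoz⟩ := hreg.exists_disjoint_cozero_sequence hinf
  have hdisj : (⨆ n, b (2 * n)) ⊓ ⨆ n, b (2 * n + 1) = ⊥ := by
    rw [eq_bot_iff, iSup_inf_eq]
    refine iSup_le fun m => ?_
    rw [inf_iSup_eq]
    exact iSup_le fun n => (hd _ _ (by omega)).le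
  rcases hPF _ (hcoz fun n => 2 * n) _ (hcoz fun n => 2 * n + 1) hdisj with h | h
  · exact not_isPseudocompact_of_isComplemented_iSup (fun n => hb _)
      (fun m n hmn => hd _ _ (by omega)) h hps
  · exact not_isPseudocompact_of_isComplemented_iSup (fun n => hb _)
      (fun m n hmn => hd _ _ (by omega)) h hps

end Finiteness

end PointFree

theorem mainTheorem11 (L : Type u) [Order.Frame L]
    (hreg : PointFree.IsCompletelyRegular L) (hPF : PointFree.IsPFFrame L) :
    (PointFree.IsCompactFrame L → Finite L) ∧ (PointFree.IsPseudocompact L → Finite L) :=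
  ⟨fun h => PointFree.IsPFFrame.finite hreg hPF h.isPseudocompact,
    fun h => PointFree.IsPFFrame.finite hreg hPF h⟩
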